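/- **Definitions.** A quantum protocol for a function $f:\{0,1\}^n\times\{0,1\}^n\to\{0,1\}$ (without prior entanglement) works on finitely many qubits, each of which belongs to Alice or to Bob. At the start Alice's qubits hold her input $x$ and Bob's hold his input $y$; all their further qubits are in state $|0\rangle$. In each communication round one player performs a unitary transformation on the qubits in his possession and then sends one of his qubits to the other player. At the end one player may perform a further unitary transformation on the qubits in his possession, and then one of his qubits is measured; the result is the output. The players acting, the unitary transformations, the qubits sent and the qubit measured are fixed in advance, independently of the inputs. The communication of the protocol is the number of qubits sent. $BQC(f)$ is the least communication of a quantum protocol that outputs $f(x,y)$ with probability at least $2/3$ on every input $(x,y)$. For $F:\{0,1\}^n\times\{0,1\}^n\to\mathbb R$ and $z,z'\in\{0,1\}^n$ let $$\hat F_{z,z'}=\frac1{2^{2n}}\sum_{x,y\in\{0,1\}^n}F(x,y)\,(-1)^{\sum_i x_iz_i+\sum_i y_iz'_i}.$$ **Theorem 4.1.** Let $f:\{0,1\}^n\times\{0,1\}^n\to\{0,1\}$ be a total Boolean function and let $F$ be $f$ itself as a real-valued function, or $F=2f-1$ (the same function with range $\{-1,1\}$). Let $E\subseteq\{(z,z):z\in\{0,1\}^n\}$,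 $\kappa_0=|E|$ and $\kappa_1=\sum_{(z,z)\in E}|\hat F_{z,z}|$, and suppose $\kappa_1>0$. Write $\log$ for $\log_2$. 1. If $\kappa_1\ge\Omega(\sqrt{\kappa_0})$, then $BQC(f)=\Omega(\log\kappa_1)$. That is, for every $a>0$ there is $C>0$, depending only on $a$, such that $BQC(f)\ge C\log\kappa_1$ for all $n,f,F,E$ as above with $\kappa_1\ge a\sqrt{\kappa_0}$. 2. If $\kappa_1\le O(\sqrt{\kappa_0})$, then $BQC(f)=\Omega\bigl(\log\kappa_1/(\log\sqrt{\kappa_0}-\log\kappa_1+1)\bigr)$. That is, for every $b>0$ there is $C>0$, depending only on $b$, such that $$BQC(f)\ge C\cdot\frac{\log\kappa_1}{\log\sqrt{\kappa_0}-\log\kappa_1+1}$$ for all $n,f,F,E$ as above with $\kappa_1\le b\sqrt{\kappa_0}$. -/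

import Mathlib

namespace QuantumCommunication

/-! ### Quantum communication protocols without prior entanglement -/

/-- The two parties of a communication protocol. -/
inductive Player where
  | alice : Player
  | bob : Player
  deriving DecidableEq

/-- The other party. -/
def Player.other : Player → Player
  | .alice => .bob
  | .bob => .alice

/-- (Unnormalised) state vectors on the qubits `Q`: amplitudes in the computational basis. -/
abbrev State (Q : Type) : Type := (Q → Bool) → ℂ

/-- The qubits that belong to player `p` when the possession of the qubits is given by `owner`. -/
abbrev Held {Q : Type} (owner : Q → Player) (p : Player) : Type := {i : Q // owner i = p}

/-- The basis string `s` with the qubits held by `p` replaced by `t`. -/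
def overwrite {Q : Type} (owner : Q → Player) (p : Player)
    (s : Q → Bool) (t : Held owner p → Bool) : Q → Bool :=
  fun i => if h : owner i = p then t ⟨i, h⟩ else s i

/-- The action of `U ⊗ 1` on a state, where `U` acts on the qubits held by `p`. -/
noncomputable def applyLocal {Q : Type} [Fintype Q] [DecidableEq Q] (owner : Q → Player)
    (p : Player) (U : Matrix (Held owner p → Bool) (Held owner p → Bool) ℂ)
    (ψ : State Q) : State Q :=
  fun s => ∑ t : Held owner p → Bool, U (fun i => s i.1) t * ψ (overwrite owner p s t)

/-- `Protocol owner c` is the type of quantum protocols on the qubits `Q` in which exactly `c`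
qubits are communicated, when at the start the qubits are distributed according to `owner`.

In a communication round (`round`) player `p` performs a unitary transformation on the qubits in
his possession and then sends one of his qubits `i` to the other player; this changes only the
possession of that qubit. At the end (`measure`) a player `p` may once more perform a unitary
transformation on his qubits (possibly the identity), and one of his qubits is measured in the
computational basis.
Unitaries, senders and the qubits sent are fixed in advance: they do not depend on the inputs. -/
inductive Protocol {Q : Type} [Fintype Q] [DecidableEq Q] : (Q → Player) → ℕ → Type where
  | measure {owner : Q → Player} (p : Player)
      (U : Matrix.unitaryGroup (Held owner p → Bool) ℂ) (i : Held owner p) : Protocol owner 0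
  | round {owner : Q → Player} {c : ℕ} (p : Player)
      (U : Matrix.unitaryGroup (Held owner p → Bool) ℂ) (i : Held owner p)
      (rest : Protocol (Function.update owner i.1 p.other) c) : Protocol owner (c + 1)

/-- The probability that the protocol, run on the state `ψ`, outputs the bit `b`. -/
noncomputable def Protocol.outputProb {Q : Type} [Fintype Q] [DecidableEq Q] :
    {owner : Q → Player} → {c : ℕ} → Protocol owner c → State Q → Bool → ℝ
  | owner, _, .measure p U i, ψ, b =>
      ∑ s : Q → Bool, if s i.1 = b then ‖applyLocal owner p U.1 ψ s‖ ^ 2 else 0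
  | owner, _, .round p U _ rest, ψ, b => rest.outputProb (applyLocal owner p U.1 ψ) b

/-- Bit strings of length `n`. -/
abbrev Str (n : ℕ) : Type := Fin n → Bool

/-- The qubits of a protocol on inputs of length `n`: Alice has `n` input qubits and `a` work
qubits (left summand), Bob has `n` input qubits and `b` work qubits (right summand). -/
abbrev Qubits (n a b : ℕ) : Type := (Fin n ⊕ Fin a) ⊕ (Fin n ⊕ Fin b)

/-- The possession of the qubits at the start. -/
def initialOwner (n a b : ℕ) : Qubits n a b → Player :=
  Sum.elim (fun _ => .alice) (fun _ => .bob)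

/-- The basis string of the initial state: the input qubits hold `x` and `y`, the work qubits
are all `0`. -/
def initialString {n a b : ℕ} (x y : Str n) : Qubits n a b → Bool :=
  Sum.elim (Sum.elim x (fun _ => false)) (Sum.elim y (fun _ => false))

/-- The initial state `|x, 0, y, 0⟩`. -/
noncomputable def initialState {n a b : ℕ} (x y : Str n) : State (Qubits n a b) :=
  Pi.single (initialString x y) 1

/-- The protocol gives the correct answer with probability at least `1 - ε` on every input. -/
def Protocol.Computes {n a b c : ℕ} (P : Protocol (initialOwner n a b) c) (ε : ℝ)
    (f : Str n → Str n → Bool) : Prop :=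
  ∀ x y : Str n, 1 - ε ≤ P.outputProb (initialState x y) (f x y)

/-- The quantum communication complexity of `f` with error `ε`: the least number of qubits
exchanged by a protocol, with any number of work qubits, that computes `f` with error `ε`. -/
noncomputable def BQCε {n : ℕ} (ε : ℝ) (f : Str n → Str n → Bool) : ℕ :=
  sInf {c : ℕ | ∃ (a b : ℕ) (P : Protocol (initialOwner n a b) c), P.Computes ε f}

/-- The bounded error quantum communication complexity (error `1/3`). -/
noncomputable def BQC {n : ℕ} (f : Str n → Str n → Bool) : ℕ := BQCε (1 / 3) f

/-! ### The minimum is over a nonempty set -/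

theorem overwrite_self {Q : Type} (owner : Q → Player) (p : Player) (s : Q → Bool) :
    overwrite owner p s (fun i => s i.1) = s := by
  funext i
  simp [overwrite]

theorem applyLocal_one {Q : Type} [Fintype Q] [DecidableEq Q] (owner : Q → Player)
    (p : Player) (ψ : State Q) : applyLocal owner p 1 ψ = ψ := by
  funext s
  simp [applyLocal, Matrix.one_apply, overwrite_self]

/-- If Bob can produce the required output when he holds all qubits, then there is a protocol in
which Alice first sends her qubits to Bob. -/
theorem exists_send_all {Q : Type} [Fintype Q] [DecidableEq Q]
    (P₀ : Protocol (fun _ : Q => Player.bob) 0) (k : ℕ) (owner : Q → Player)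
    (hk : (Finset.univ.filter (fun i => owner i = Player.alice)).card = k) :
    ∃ P : Protocol owner k, ∀ ψ b, P.outputProb ψ b = P₀.outputProb ψ b := by
  induction k generalizing owner with
  | zero =>
    have h : owner = fun _ => Player.bob := by
      funext i
      rw [Finset.card_eq_zero, Finset.filter_eq_empty_iff] at hk
      have := hk (Finset.mem_univ i)
      cases h : owner i <;> simp_all
    subst h
    exact ⟨P₀, fun _ _ => rfl⟩
  | succ k ih =>
    obtain ⟨i, hi⟩ := Finset.card_pos.1 (by rw [hk]; exact Nat.succ_pos k)
    have hi' : owner i = Player.alice := (Finset.mem_filter.1 hi).2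
    obtain ⟨P, hP⟩ := ih (Function.update owner i Player.alice.other) (by
      have : (Finset.univ.filter
          (fun j => Function.update owner i Player.alice.other j = Player.alice))
          = (Finset.univ.filter (fun j => owner j = Player.alice)).erase i := by
        ext j
        by_cases h : j = i
        · subst h
          rw [Finset.mem_filter, Function.update_self]
          simp [Player.other]
        · simp only [Finset.mem_filter, Finset.mem_erase, Function.update_of_ne h]
          simp [h]
      rw [this, Finset.card_erase_of_mem hi, hk]
      rfl)
    refine ⟨.round Player.alice 1 ⟨i, hi'⟩ P, fun ψ b => ?_⟩
    rw [Protocol.outputProb]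
    simp only [OneMemClass.coe_one, applyLocal_one]
    exact hP ψ b

/-- The permutation matrix of an involution is unitary. -/
theorem involution_mem_unitaryGroup {T : Type} [Fintype T] [DecidableEq T] (σ : T → T)
    (hσ : ∀ t, σ (σ t) = t) :
    (Matrix.of fun s t => if s = σ t then (1 : ℂ) else 0) ∈ Matrix.unitaryGroup T ℂ := by
  rw [Matrix.mem_unitaryGroup_iff]
  ext s t
  have h : ∀ u, (s = σ u) ↔ (u = σ s) := fun u =>
    ⟨fun h => by rw [h, hσ], fun h => by rw [h, hσ]⟩
  simp only [Matrix.mul_apply, Matrix.star_apply, Matrix.of_apply, Matrix.one_apply, h]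
  simp only [ite_mul, one_mul, zero_mul, Finset.sum_ite_eq', Finset.mem_univ, if_true, hσ]
  by_cases hst : s = t <;> simp [hst, eq_comm]

/-- For every function there is a protocol that computes it without error. -/
theorem exists_protocol {n : ℕ} {ε : ℝ} (hε : 0 ≤ ε) (f : Str n → Str n → Bool) :
    ∃ (c a b : ℕ) (P : Protocol (initialOwner n a b) c), P.Computes ε f := by
  let m : Held (fun _ : Qubits n 0 1 => Player.bob) Player.bob := ⟨.inr (.inr 0), rfl⟩
  let g : (Held (fun _ : Qubits n 0 1 => Player.bob) Player.bob → Bool) → Bool := fun t =>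
    f (fun j => t ⟨.inl (.inl j), rfl⟩) (fun j => t ⟨.inr (.inl j), rfl⟩)
  let σ : (Held (fun _ : Qubits n 0 1 => Player.bob) Player.bob → Bool) →
      (Held (fun _ : Qubits n 0 1 => Player.bob) Player.bob → Bool) := fun t =>
    Function.update t m (xor (t m) (g t))
  have hg : ∀ t v, g (Function.update t m v) = g t := by
    intro t v
    simp [g, m]
  have hσ : ∀ t, σ (σ t) = t := by
    intro t
    simp [σ, hg]
  obtain ⟨P, hP⟩ := exists_send_all
    (Protocol.measure Player.bob ⟨_, involution_mem_unitaryGroup σ hσ⟩ m) _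
    (initialOwner n 0 1) rfl
  refine ⟨_, 0, 1, P, fun x y => ?_⟩
  rw [hP, Protocol.outputProb]
  let s₀ : Qubits n 0 1 → Bool := initialString x y
  let s₁ : Qubits n 0 1 → Bool := fun i => σ (fun j => s₀ j.1) ⟨i, rfl⟩
  have hamp : applyLocal (fun _ : Qubits n 0 1 => Player.bob) Player.bob
      (Matrix.of fun s t => if s = σ t then (1 : ℂ) else 0) (initialState x y) s₁ = 1 := by
    rw [applyLocal, Finset.sum_eq_single (fun j => s₀ j.1)]
    · have : overwrite (fun _ : Qubits n 0 1 => Player.bob) Player.bob s₁ (fun j => s₀ j.1)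
          = initialString x y := by
        funext j
        simp [overwrite, s₀]
      rw [this, initialState, Pi.single_eq_same, mul_one, Matrix.of_apply, if_pos]
      rfl
    · intro t _ ht
      have : overwrite (fun _ : Qubits n 0 1 => Player.bob) Player.bob s₁ t
          ≠ initialString x y := by
        intro h
        apply ht
        funext j
        simpa [overwrite] using congrFun h j.1
      simp [initialState, Pi.single_eq_of_ne this]
    · simp
  have hout : s₁ m.1 = f x y := by
    simp [s₁, σ, m, s₀, g, initialString]
  have hle := Finset.single_le_sum
    (f := fun s : Qubits n 0 1 → Bool => if s m.1 = f x y then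
      ‖applyLocal (fun _ : Qubits n 0 1 => Player.bob) Player.bob
        (Matrix.of fun s t => if s = σ t then (1 : ℂ) else 0) (initialState x y) s‖ ^ 2 else 0)
    (fun s _ => by positivity) (Finset.mem_univ s₁)
  simp only [hout, if_true, hamp] at hle
  norm_num at hle
  refine le_trans (by linarith) hle

/-! ### Fourier coefficients -/

/-- `∑ i, x i ∧ z i`, whose parity is the inner product modulo 2. -/
def ip {n : ℕ} (x z : Str n) : ℕ := ∑ i, (x i && z i).toNat

/-- The basis function `χ_{z,z'}(x,y) = (-1)^(IP(x,z) + IP(y,z'))`. -/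
def χ {n : ℕ} (z z' x y : Str n) : ℝ := (-1) ^ (ip x z + ip y z')

/-- The Fourier coefficient `⟨F, χ_{z,z'}⟩` with respect to the normalised inner product on
real functions on `{0,1}^n × {0,1}^n`. -/
noncomputable def fourierCoeff {n : ℕ} (F : Str n → Str n → ℝ) (z z' : Str n) : ℝ :=
  1 / 2 ^ (2 * n) * ∑ x, ∑ y, F x y * χ z z' x y

/-- The set of all diagonal indices `(z, z)`. -/
def diagonalIndices (n : ℕ) : Set (Str n × Str n) := {p | p.1 = p.2}

/-- The number of coefficients considered. -/
def κ₀ {n : ℕ} (E : Finset (Str n × Str n)) : ℕ := E.card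

/-- The sum of the absolute values of the coefficients considered. -/
noncomputable def κ₁ {n : ℕ} (F : Str n → Str n → ℝ) (E : Finset (Str n × Str n)) : ℝ :=
  ∑ p ∈ E, |fourierCoeff F p.1 p.2|

/-- A Boolean function as a real function with range `{0, 1}`. -/
def zeroOne {n : ℕ} (f : Str n → Str n → Bool) : Str n → Str n → ℝ :=
  fun x y => if f x y then 1 else 0

/-- A Boolean function as a real function with range `{-1, 1}`. -/
def plusMinusOne {n : ℕ} (f : Str n → Str n → Bool) : Str n → Str n → ℝ :=
  fun x y => if f x y then 1 else -1

end QuantumCommunication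

open QuantumCommunication

namespace QuantumCommunication

/-! The `γ₂` norm of the matrix of acceptance probabilities links communication to Fourier mass.
Write the state of a protocol as a sum of products of a vector depending on `x` and one depending on
`y`. Local unitaries preserve the total squared norms, each sent qubit at most doubles them, and the
measurement squares the bound, so `c` qubits give `γ₂` at most `4 ^ c` (`FactorsLE.send`,
`Protocol.gammaTwoLE`). On the other side, the absolute values of the diagonal coefficients of a
matrix sum to at most its `γ₂` norm (`GammaTwoLE.sum_norm_diagCoeff_le`).

The acceptance matrix only approximates `f`. An entrywise error `ε` contributes at most `ε √κ₀` on
`E`, by Bessel and Cauchy–Schwarz, so `ε` has to fall below about `κ₁ / √κ₀`. Instead of repeating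
the protocol, a majority polynomial of degree `2m` is applied to each entry: the error becomes
`(8/9) ^ m`, while `γ₂` stays below `(1 + 2 * 4 ^ c) ^ (2m)`. With `m` of order `D = log √κ₀ - log
κ₁ + 1` the error accounts for at most half of `κ₁`, and `log κ₁ = O(c D)` for `c ≥ 1`; for `c = 0`
one has `κ₁ ≤ 1`. Both claims are read off from `logb_κ₁_le`. -/

/-! ### Walsh characters and Parseval's identity -/

/-- The Walsh character `x ↦ (-1)^⟨x, z⟩`. -/
def walsh {n : ℕ} (z x : Str n) : ℂ := (-1) ^ ip x z

theorem norm_walsh {n : ℕ} (z x : Str n) : ‖walsh z x‖ = 1 := by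
  simp [walsh]

theorem conj_walsh {n : ℕ} (z x : Str n) : (starRingEnd ℂ) (walsh z x) = walsh z x := by
  simp [walsh]

theorem walsh_eq_prod {n : ℕ} (z x : Str n) :
    walsh z x = ∏ i, (-1 : ℂ) ^ (x i && z i).toNat := by
  rw [walsh, ip, Finset.prod_pow_eq_pow_sum]

/-- Characters are products over the coordinates, so the sum factorises into one sum over `Bool` per
coordinate. -/
theorem sum_walsh_mul_walsh {n : ℕ} (x y : Str n) :
    ∑ z, walsh z x * walsh z y = if x = y then (2 : ℂ) ^ n else 0 := by
  have h : ∀ i, ∑ b : Bool, (-1 : ℂ) ^ (x i && b).toNat * (-1 : ℂ) ^ (y i && b).toNat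
      = if x i = y i then 2 else 0 := by
    intro i
    cases x i <;> cases y i <;> norm_num
  simp only [walsh_eq_prod, ← Finset.prod_mul_distrib]
  rw [← Fintype.piFinset_univ, ← Finset.prod_univ_sum (fun _ => Finset.univ)
    (fun i b => (-1 : ℂ) ^ (x i && b).toNat * (-1 : ℂ) ^ (y i && b).toNat)]
  simp only [h, Finset.prod_ite_zero, Finset.mem_univ, true_implies, Finset.prod_const,
    Finset.card_univ, Fintype.card_fin, funext_iff]

theorem parseval {n : ℕ} (u : Str n → ℂ) :
    ∑ z, ‖∑ x, u x * walsh z x‖ ^ 2 = 2 ^ n * ∑ x, ‖u x‖ ^ 2 := by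
  have h : ∀ a : ℂ, ((‖a‖ ^ 2 : ℝ) : ℂ) = a * (starRingEnd ℂ) a := by
    intro a
    rw [Complex.mul_conj, Complex.normSq_eq_norm_sq]
  apply Complex.ofReal_injective
  push_cast [h]
  simp only [map_sum, map_mul, conj_walsh, Finset.sum_mul_sum]
  rw [Finset.sum_comm, Finset.mul_sum]
  refine Finset.sum_congr rfl fun x _ => ?_
  rw [Finset.sum_comm]
  have : ∀ y, ∑ z, u x * walsh z x * ((starRingEnd ℂ) (u y) * walsh z y)
      = u x * (starRingEnd ℂ) (u y) * if x = y then (2 : ℂ) ^ n else 0 := by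
    intro y
    rw [← sum_walsh_mul_walsh, Finset.mul_sum]
    exact Finset.sum_congr rfl fun z _ => by ring
  simp only [this]
  simp
  ring

/-- The diagonal Fourier coefficient of a complex matrix. -/
noncomputable def diagCoeff {n : ℕ} (M : Str n → Str n → ℂ) (z : Str n) : ℂ :=
  1 / 2 ^ (2 * n) * ∑ x, ∑ y, M x y * walsh z x * walsh z y

theorem abs_fourierCoeff {n : ℕ} (F : Str n → Str n → ℝ) (z : Str n) :
    |fourierCoeff F z z| = ‖diagCoeff (fun x y => (F x y : ℂ)) z‖ := by
  rw [← Real.norm_eq_abs, ← Complex.norm_real]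
  congr 1
  simp [fourierCoeff, diagCoeff, χ, walsh, pow_add, mul_assoc]

theorem diagCoeff_add {n : ℕ} (M N : Str n → Str n → ℂ) (z : Str n) :
    diagCoeff (fun x y => M x y + N x y) z = diagCoeff M z + diagCoeff N z := by
  simp [diagCoeff, add_mul, Finset.sum_add_distrib, mul_add]

/-- Bessel's inequality for the diagonal Fourier coefficients of a bounded matrix. -/
theorem sum_norm_sq_diagCoeff_le {n : ℕ} {M : Str n → Str n → ℂ} {ε : ℝ}
    (hM : ∀ x y, ‖M x y‖ ≤ ε) : ∑ z, ‖diagCoeff M z‖ ^ 2 ≤ ε ^ 2 := by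
  have hN : (0 : ℝ) < 2 ^ n := by positivity
  -- The sign `walsh z y` is dropped and Cauchy–Schwarz over `y` costs `2 ^ n`; Parseval in `x` for
  -- each fixed `y` then suffices.
  have h1 : ∀ z, ‖diagCoeff M z‖ ^ 2
      ≤ 1 / (2 ^ n) ^ 3 * ∑ y, ‖∑ x, M x y * walsh z x‖ ^ 2 := by
    intro z
    have e : diagCoeff M z = 1 / (2 ^ n) ^ 2 * ∑ y, walsh z y * ∑ x, M x y * walsh z x := by
      rw [diagCoeff, Finset.sum_comm, mul_comm 2 n, pow_mul]
      simp only [Finset.mul_sum]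
      refine Finset.sum_congr rfl fun y _ => Finset.sum_congr rfl fun x _ => by ring
    have h2 : ‖∑ y, walsh z y * ∑ x, M x y * walsh z x‖
        ≤ ∑ y, ‖∑ x, M x y * walsh z x‖ := by
      refine (norm_sum_le _ _).trans (le_of_eq ?_)
      simp [norm_walsh]
    have h3 : (∑ y, ‖∑ x, M x y * walsh z x‖) ^ 2
        ≤ 2 ^ n * ∑ y, ‖∑ x, M x y * walsh z x‖ ^ 2 := by
      have := sq_sum_le_card_mul_sum_sq (s := (Finset.univ : Finset (Str n)))
        (f := fun y => ‖∑ x, M x y * walsh z x‖)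
      simpa using this
    rw [e, norm_mul, mul_pow]
    have h4 := (pow_le_pow_left₀ (norm_nonneg _) h2 2).trans h3
    calc _ ≤ ‖(1 / (2 ^ n) ^ 2 : ℂ)‖ ^ 2 * (2 ^ n * ∑ y, ‖∑ x, M x y * walsh z x‖ ^ 2) := by
          gcongr
      _ = _ := by
          simp only [norm_div, norm_pow, norm_one, Complex.norm_ofNat]
          field_simp
  calc _ ≤ ∑ z, 1 / (2 ^ n) ^ 3 * ∑ y, ‖∑ x, M x y * walsh z x‖ ^ 2 :=
        Finset.sum_le_sum fun z _ => h1 z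
    _ = 1 / (2 ^ n) ^ 3 * ∑ y, 2 ^ n * ∑ x, ‖M x y‖ ^ 2 := by
        rw [← Finset.mul_sum, Finset.sum_comm]
        simp only [parseval]
    _ ≤ 1 / (2 ^ n) ^ 3 * ∑ y : Str n, 2 ^ n * ∑ x : Str n, ε ^ 2 := by
        gcongr
        exact hM _ _
    _ = ε ^ 2 := by
        simp
        field_simp

/-- On the diagonal the first projection is injective, so no `z` is counted twice. -/
theorem sum_diagonal_le {n : ℕ} {E : Finset (Str n × Str n)}
    (hE : (E : Set (Str n × Str n)) ⊆ diagonalIndices n) {h : Str n → ℝ} (h0 : ∀ z, 0 ≤ h z) :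
    ∑ p ∈ E, h p.1 ≤ ∑ z, h z := by
  have inj : Set.InjOn Prod.fst (E : Set (Str n × Str n)) := by
    rintro ⟨a, b⟩ hp ⟨c, d⟩ hq hpq
    have h1 : a = b := hE hp
    have h2 : c = d := hE hq
    simp_all
  rw [← Finset.sum_image (f := h) inj]
  exact Finset.sum_le_sum_of_subset_of_nonneg (Finset.subset_univ _) fun z _ _ => h0 z

/-- Cauchy–Schwarz over `E` combined with Bessel; this controls the approximation error. -/
theorem sum_norm_diagCoeff_le {n : ℕ} {E : Finset (Str n × Str n)}
    (hE : (E : Set (Str n × Str n)) ⊆ diagonalIndices n) {M : Str n → Str n → ℂ} {ε : ℝ}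
    (hε : 0 ≤ ε) (hM : ∀ x y, ‖M x y‖ ≤ ε) :
    ∑ p ∈ E, ‖diagCoeff M p.1‖ ≤ ε * √(κ₀ E : ℝ) := by
  have h1 := sq_sum_le_card_mul_sum_sq (s := E) (f := fun p => ‖diagCoeff M p.1‖)
  have h2 := sum_diagonal_le hE (h := fun z => ‖diagCoeff M z‖ ^ 2) fun z => by positivity
  have h3 := sum_norm_sq_diagCoeff_le hM
  refine le_of_sq_le_sq ?_ (by positivity)
  rw [mul_pow, Real.sq_sqrt (by positivity), κ₀]
  calc _ ≤ _ := h1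
    _ ≤ (E.card : ℝ) * ε ^ 2 := by gcongr; exact h2.trans h3
    _ = _ := mul_comm _ _

theorem κ₁_eq {n : ℕ} {E : Finset (Str n × Str n)}
    (hE : (E : Set (Str n × Str n)) ⊆ diagonalIndices n) (F : Str n → Str n → ℝ) :
    κ₁ F E = ∑ p ∈ E, ‖diagCoeff (fun x y => (F x y : ℂ)) p.1‖ := by
  refine Finset.sum_congr rfl fun p hp => ?_
  have : p.1 = p.2 := hE hp
  rw [← abs_fourierCoeff, ← this]

/-! ### Factorisations of bounded norm -/

/-- The matrix `M` is a matrix of inner products `∑ k, u k x * v k y` of vectors of squared norm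
at most `R`; in other words its `γ₂` norm is at most `R`. -/
def GammaTwoLE {X Y : Type} (M : X → Y → ℂ) (R : ℝ) : Prop :=
  ∃ (K : Type) (_ : Fintype K) (u : K → X → ℂ) (v : K → Y → ℂ),
    (∀ x y, M x y = ∑ k, u k x * v k y) ∧
    (∀ x, ∑ k, ‖u k x‖ ^ 2 ≤ R) ∧ ∀ y, ∑ k, ‖v k y‖ ^ 2 ≤ R

namespace GammaTwoLE

variable {X Y : Type} {M N : X → Y → ℂ} {R S : ℝ}

theorem mono (h : GammaTwoLE M R) (hRS : R ≤ S) : GammaTwoLE M S := by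
  obtain ⟨K, _, u, v, h1, h2, h3⟩ := h
  exact ⟨K, inferInstance, u, v, h1, fun x => (h2 x).trans hRS, fun y => (h3 y).trans hRS⟩

theorem of_left {g : X → ℂ} (hg : ∀ x, ‖g x‖ ≤ 1) : GammaTwoLE (fun x (_ : Y) => g x) 1 :=
  ⟨Unit, inferInstance, fun _ => g, fun _ _ => 1, by simp, fun x => by simpa using hg x, by simp⟩

theorem of_right {g : Y → ℂ} (hg : ∀ y, ‖g y‖ ≤ 1) : GammaTwoLE (fun (_ : X) y => g y) 1 :=
  ⟨Unit, inferInstance, fun _ _ => 1, fun _ => g, by simp, by simp, fun x => by simpa using hg x⟩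

theorem one : GammaTwoLE (fun (_ : X) (_ : Y) => (1 : ℂ)) 1 := of_left (by simp)

theorem zero : GammaTwoLE (fun (_ : X) (_ : Y) => (0 : ℂ)) 0 :=
  ⟨Empty, inferInstance, fun _ _ => 0, fun _ _ => 0, by simp, by simp, by simp⟩

theorem add (hM : GammaTwoLE M R) (hN : GammaTwoLE N S) :
    GammaTwoLE (fun x y => M x y + N x y) (R + S) := by
  obtain ⟨K, _, u, v, h1, h2, h3⟩ := hM
  obtain ⟨L, _, u', v', h1', h2', h3'⟩ := hN
  refine ⟨K ⊕ L, inferInstance, Sum.elim u u', Sum.elim v v', fun x y => ?_, fun x => ?_,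
    fun y => ?_⟩
  · simp [h1, h1']
  · simpa using add_le_add (h2 x) (h2' x)
  · simpa using add_le_add (h3 y) (h3' y)

/-- Tensor products of the vectors realise the entrywise product, which is why polynomials may be
applied to entries. -/
theorem mul (hM : GammaTwoLE M R) (hN : GammaTwoLE N S) (hR : 0 ≤ R) :
    GammaTwoLE (fun x y => M x y * N x y) (R * S) := by
  obtain ⟨K, _, u, v, h1, h2, h3⟩ := hM
  obtain ⟨L, _, u', v', h1', h2', h3'⟩ := hN
  refine ⟨K × L, inferInstance, fun k x => u k.1 x * u' k.2 x, fun k y => v k.1 y * v' k.2 y,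
    fun x y => ?_, fun x => ?_, fun y => ?_⟩
  · simp only [h1, h1', Finset.sum_mul_sum, Fintype.sum_prod_type]
    exact Finset.sum_congr rfl fun k _ => Finset.sum_congr rfl fun l _ => by ring
  · simp only [norm_mul, mul_pow, Fintype.sum_prod_type, ← Finset.sum_mul_sum]
    exact mul_le_mul (h2 x) (h2' x) (by positivity) hR
  · simp only [norm_mul, mul_pow, Fintype.sum_prod_type, ← Finset.sum_mul_sum]
    exact mul_le_mul (h3 y) (h3' y) (by positivity) hR

theorem smul (hM : GammaTwoLE M R) {a : ℝ} (ha : 0 ≤ a) :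
    GammaTwoLE (fun x y => (a : ℂ) * M x y) (a * R) := by
  have hs : ((√a : ℝ) : ℂ) * (√a : ℝ) = a := by
    rw [← Complex.ofReal_mul, Real.mul_self_sqrt ha]
  obtain ⟨K, _, u, v, h1, h2, h3⟩ := hM
  refine ⟨K, inferInstance, fun k x => (√a : ℝ) * u k x, fun k y => (√a : ℝ) * v k y,
    fun x y => ?_, fun x => ?_, fun y => ?_⟩
  · simp only [h1, ← hs, Finset.mul_sum]
    exact Finset.sum_congr rfl fun k _ => by ring
  · simp only [norm_mul, mul_pow, Complex.norm_real, Real.norm_eq_abs, sq_abs, Real.sq_sqrt ha,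
      ← Finset.mul_sum]
    exact mul_le_mul_of_nonneg_left (h2 x) ha
  · simp only [norm_mul, mul_pow, Complex.norm_real, Real.norm_eq_abs, sq_abs, Real.sq_sqrt ha,
      ← Finset.mul_sum]
    exact mul_le_mul_of_nonneg_left (h3 y) ha

theorem neg (hM : GammaTwoLE M R) : GammaTwoLE (fun x y => -M x y) R := by
  obtain ⟨K, _, u, v, h1, h2, h3⟩ := hM
  exact ⟨K, inferInstance, fun k x => -u k x, v, fun x y => by simp [h1], by simpa using h2, h3⟩

theorem pow (hM : GammaTwoLE M R) (hR : 0 ≤ R) (k : ℕ) :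
    GammaTwoLE (fun x y => M x y ^ k) (R ^ k) := by
  induction k with
  | zero => simpa using one
  | succ k ih => simpa only [pow_succ] using ih.mul hM (by positivity)

theorem sum {ι : Type} (s : Finset ι) {M : ι → X → Y → ℂ} {R : ι → ℝ}
    (h : ∀ i, GammaTwoLE (M i) (R i)) :
    GammaTwoLE (fun x y => ∑ i ∈ s, M i x y) (∑ i ∈ s, R i) := by
  classical
  induction s using Finset.induction_on with
  | empty => simpa using zero
  | insert i s hi ih => simpa only [Finset.sum_insert hi] using (h i).add ih

/-- A diagonal coefficient pairs the Walsh transforms of `u k` and `v k` at the same `z`. After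
AM–GM the sum over `z` is handled by Parseval, separately for `u` and `v`. -/
theorem sum_norm_diagCoeff_le {n : ℕ} {M : Str n → Str n → ℂ} {R : ℝ} (h : GammaTwoLE M R) :
    ∑ z, ‖diagCoeff M z‖ ≤ R := by
  obtain ⟨K, _, u, v, h1, h2, h3⟩ := h
  have e : ∀ z, diagCoeff M z = 1 / (2 ^ n) ^ 2 *
      ∑ k, (∑ x, u k x * walsh z x) * ∑ y, v k y * walsh z y := by
    intro z
    rw [diagCoeff, mul_comm 2 n, pow_mul]
    congr 1
    have : ∀ x y, M x y * walsh z x * walsh z y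
        = ∑ k, u k x * walsh z x * (v k y * walsh z y) := fun x y => by
      simp only [h1, Finset.sum_mul]
      exact Finset.sum_congr rfl fun k _ => by ring
    simp only [this, Finset.sum_mul_sum]
    rw [Finset.sum_comm (s := (Finset.univ : Finset K))]
    exact Finset.sum_congr rfl fun x _ => Finset.sum_comm
  have b : ∀ z, ‖diagCoeff M z‖ ≤ 1 / (2 ^ n) ^ 2 *
      ∑ k, (‖∑ x, u k x * walsh z x‖ ^ 2 + ‖∑ y, v k y * walsh z y‖ ^ 2) / 2 := by
    intro z
    rw [e, norm_mul]
    have : ‖(1 / (2 ^ n) ^ 2 : ℂ)‖ = 1 / (2 ^ n) ^ 2 := by simp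
    rw [this]
    gcongr
    refine (norm_sum_le _ _).trans (Finset.sum_le_sum fun k _ => ?_)
    rw [norm_mul]
    linarith [two_mul_le_add_sq ‖∑ x, u k x * walsh z x‖ ‖∑ y, v k y * walsh z y‖]
  have s : ∀ w : K → Str n → ℂ, (∀ x, ∑ k, ‖w k x‖ ^ 2 ≤ R) →
      ∑ z, ∑ k, ‖∑ x, w k x * walsh z x‖ ^ 2 ≤ (2 ^ n) ^ 2 * R := by
    intro w hw
    rw [Finset.sum_comm]
    simp only [parseval]
    rw [← Finset.mul_sum, Finset.sum_comm, sq, mul_assoc]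
    gcongr
    calc _ ≤ ∑ x : Str n, R := Finset.sum_le_sum fun x _ => hw x
      _ = _ := by simp
  calc _ ≤ _ := Finset.sum_le_sum fun z _ => b z
    _ = 1 / (2 ^ n) ^ 2 * ((∑ z, ∑ k, ‖∑ x, u k x * walsh z x‖ ^ 2
          + ∑ z, ∑ k, ‖∑ y, v k y * walsh z y‖ ^ 2) / 2) := by
        simp only [← Finset.mul_sum, ← Finset.sum_div, Finset.sum_add_distrib]
    _ ≤ 1 / (2 ^ n) ^ 2 * (((2 ^ n) ^ 2 * R + (2 ^ n) ^ 2 * R) / 2) := by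
        gcongr
        · exact s u h2
        · exact s v h3
    _ = R := by field_simp; ring

end GammaTwoLE

/-! ### Error reduction by a polynomial -/

/-- The probability that more than `m` of `2 * m` independent coins of bias `t` show heads. -/
def majorityPoly {R : Type} [CommRing R] (m : ℕ) (t : R) : R :=
  ∑ j ∈ (Finset.range (2 * m + 1)).filter (m < ·),
    ((2 * m).choose j : R) * (t ^ j * (1 - t) ^ (2 * m - j))

/-- Replacing `t` by `R` and `1 - t` by `1 + R` bounds each term; the full binomial sum is `(R + (1
+ R)) ^ (2m)`. -/
theorem GammaTwoLE.majorityPoly {X Y : Type} {M : X → Y → ℂ} {R : ℝ} (h : GammaTwoLE M R)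
    (hR : 0 ≤ R) (m : ℕ) :
    GammaTwoLE (fun x y => majorityPoly m (M x y)) ((1 + 2 * R) ^ (2 * m)) := by
  have h' : GammaTwoLE (fun x y => 1 - M x y) (1 + R) := by
    simpa only [sub_eq_add_neg] using one.add h.neg
  refine (GammaTwoLE.sum _ fun j =>
    (((h.pow hR j).mul (h'.pow (by positivity) (2 * m - j)) (by positivity)).smul
      (a := ((2 * m).choose j : ℝ)) (by positivity))).mono ?_
  rw [show 1 + 2 * R = R + (1 + R) by ring, add_pow]
  refine (Finset.sum_le_sum_of_subset_of_nonneg (Finset.filter_subset _ _) fun j _ _ => ?_).trans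
    (le_of_eq (Finset.sum_congr rfl fun j _ => by ring))
  positivity

theorem majorityPoly_complement (m : ℕ) (t : ℝ) :
    1 - majorityPoly m t = ∑ j ∈ (Finset.range (2 * m + 1)).filter (¬ m < ·),
      ((2 * m).choose j : ℝ) * (t ^ j * (1 - t) ^ (2 * m - j)) := by
  rw [majorityPoly, sub_eq_iff_eq_add', Finset.sum_filter_add_sum_filter_not]
  have := add_pow t (1 - t) (2 * m)
  rw [add_sub_cancel, one_pow] at this
  refine this.trans (Finset.sum_congr rfl fun j _ => ?_)
  ring

/-- Each selected outcome has weight at most `(2/9) ^ m`, and there are at most `4 ^ m` outcomes. -/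
theorem sum_binomial_le {m : ℕ} {t : ℝ} (ht : 0 ≤ t) (ht1 : t ≤ 1)
    (hq : t * (1 - t) ≤ 2 / 9) (p : ℕ → Prop) [DecidablePred p]
    (hp : ∀ j ≤ 2 * m, p j → t ^ j * (1 - t) ^ (2 * m - j) ≤ (t * (1 - t)) ^ m) :
    ∑ j ∈ (Finset.range (2 * m + 1)).filter p,
      ((2 * m).choose j : ℝ) * (t ^ j * (1 - t) ^ (2 * m - j)) ≤ (8 / 9) ^ m := by
  have h0 : 0 ≤ t * (1 - t) := mul_nonneg ht (by linarith)
  calc _ ≤ ∑ j ∈ (Finset.range (2 * m + 1)).filter p, ((2 * m).choose j : ℝ) * (2 / 9) ^ m := by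
        refine Finset.sum_le_sum fun j hj => ?_
        rw [Finset.mem_filter, Finset.mem_range] at hj
        gcongr
        exact (hp j (by omega) hj.2).trans (pow_le_pow_left₀ h0 hq m)
    _ ≤ ∑ j ∈ Finset.range (2 * m + 1), ((2 * m).choose j : ℝ) * (2 / 9) ^ m :=
        Finset.sum_le_sum_of_subset_of_nonneg (Finset.filter_subset _ _) fun j _ _ => by positivity
    _ = (8 / 9) ^ m := by
        rw [← Finset.sum_mul, ← Nat.cast_sum, Nat.sum_range_choose]
        push_cast
        rw [pow_mul, ← mul_pow]
        norm_num

theorem majorityPoly_nonneg {m : ℕ} {t : ℝ} (ht : 0 ≤ t) (ht1 : t ≤ 1) :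
    0 ≤ majorityPoly m t := by
  have : 0 ≤ 1 - t := by linarith
  unfold majorityPoly
  positivity

theorem majorityPoly_le_one {m : ℕ} {t : ℝ} (ht : 0 ≤ t) (ht1 : t ≤ 1) :
    majorityPoly m t ≤ 1 := by
  rw [← sub_nonneg, majorityPoly_complement]
  have : 0 ≤ 1 - t := by linarith
  positivity

/-- Since `t ≤ 1 - t`, the factors `t` in excess of `m` may be traded for factors `1 - t`. -/
theorem majorityPoly_le {m : ℕ} {t : ℝ} (ht : 0 ≤ t) (ht1 : t ≤ 1 / 3) :
    majorityPoly m t ≤ (8 / 9) ^ m := by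
  refine sum_binomial_le ht (by linarith) (by nlinarith) (m < ·) fun j hj hmj => ?_
  obtain ⟨d, rfl⟩ := Nat.exists_eq_add_of_lt hmj
  have h0 : 0 ≤ 1 - t := by linarith
  have : (1 - t) ^ m = (1 - t) ^ (2 * m - (m + d + 1)) * (1 - t) ^ (d + 1) := by
    rw [← pow_add]
    congr 1
    omega
  rw [mul_pow, this, add_assoc, pow_add t m]
  have h1 : t ^ (d + 1) ≤ (1 - t) ^ (d + 1) := pow_le_pow_left₀ ht (by linarith) _
  calc _ = t ^ m * (1 - t) ^ (2 * m - (m + (d + 1))) * t ^ (d + 1) := by ring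
    _ ≤ t ^ m * (1 - t) ^ (2 * m - (m + (d + 1))) * (1 - t) ^ (d + 1) := by gcongr
    _ = _ := by ring_nf

theorem one_sub_majorityPoly_le {m : ℕ} {t : ℝ} (ht : 2 / 3 ≤ t) (ht1 : t ≤ 1) :
    1 - majorityPoly m t ≤ (8 / 9) ^ m := by
  rw [majorityPoly_complement]
  refine sum_binomial_le (by linarith) ht1 (by nlinarith) (¬ m < ·) fun j hj hmj => ?_
  obtain ⟨d, rfl⟩ := Nat.exists_eq_add_of_le (not_lt.1 hmj)
  have h0 : 0 ≤ 1 - t := by linarith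
  have : (1 - t) ^ (2 * (j + d) - j) = (1 - t) ^ (j + d) * (1 - t) ^ d := by
    rw [← pow_add]
    congr 1
    omega
  rw [this, mul_pow, pow_add t]
  have h1 : (1 - t) ^ d ≤ t ^ d := pow_le_pow_left₀ h0 (by linarith) _
  have h2 : 0 ≤ t := by linarith
  calc _ = t ^ j * (1 - t) ^ (j + d) * (1 - t) ^ d := by ring
    _ ≤ t ^ j * (1 - t) ^ (j + d) * t ^ d := by gcongr
    _ = _ := by ring

end QuantumCommunication
namespace QuantumCommunication

/-! ### Local unitaries -/

theorem ofReal_norm_sq (a : ℂ) : ((‖a‖ ^ 2 : ℝ) : ℂ) = a * star a := by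
  rw [RCLike.star_def, Complex.mul_conj, Complex.normSq_eq_norm_sq]

theorem sum_norm_sq_mulVec {T : Type} [Fintype T] [DecidableEq T]
    (U : Matrix.unitaryGroup T ℂ) (v : T → ℂ) :
    ∑ s, ‖U.1.mulVec v s‖ ^ 2 = ∑ s, ‖v s‖ ^ 2 := by
  apply Complex.ofReal_injective
  simp only [Complex.ofReal_sum, ofReal_norm_sq]
  change U.1.mulVec v ⬝ᵥ star (U.1.mulVec v) = v ⬝ᵥ star v
  rw [Matrix.star_mulVec, dotProduct_comm, ← Matrix.dotProduct_mulVec, Matrix.mulVec_mulVec,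
    ← Matrix.star_eq_conjTranspose, Unitary.star_mul_self_of_mem U.2, Matrix.one_mulVec,
    dotProduct_comm]

section

theorem overwrite_held {Q : Type} (owner : Q → Player) (p : Player) (s : Q → Bool)
    (t : Held owner p → Bool) (i : Held owner p) : overwrite owner p s t i.1 = t i := by
  simp [overwrite, i.2]

theorem overwrite_not_held {Q : Type} {owner : Q → Player} {p : Player} (s : Q → Bool)
    (t : Held owner p → Bool) {i : Q} (hi : owner i ≠ p) : overwrite owner p s t i = s i := by
  simp [overwrite, hi]

variable {Q : Type} [Fintype Q] [DecidableEq Q]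

/-- Splitting a basis string into the part held by `p` and the rest. -/
theorem sum_split (owner : Q → Player) (p : Player) {α : Type} [AddCommMonoid α]
    (g : (Q → Bool) → α) :
    ∑ s, g s = ∑ r : {i // owner i ≠ p} → Bool, ∑ t : Held owner p → Bool,
      g (fun i => if h : owner i = p then t ⟨i, h⟩ else r ⟨i, h⟩) := by
  rw [← Equiv.sum_comp ((Equiv.prodComm _ _).trans
    (Equiv.piEquivPiSubtypeProd (fun i => owner i = p) (fun _ => Bool)).symm),
    Fintype.sum_prod_type]
  rfl

/-- For fixed contents of the qubits not held by `p`, the action is `U` applied to a slice of `ψ`.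
-/
theorem sum_norm_sq_applyLocal (owner : Q → Player) (p : Player)
    (U : Matrix.unitaryGroup (Held owner p → Bool) ℂ) (ψ : State Q) :
    ∑ s, ‖applyLocal owner p U.1 ψ s‖ ^ 2 = ∑ s, ‖ψ s‖ ^ 2 := by
  rw [sum_split (α := ℝ) owner p, sum_split owner p (fun s => ‖ψ s‖ ^ 2)]
  refine Finset.sum_congr rfl fun r _ => ?_
  refine Eq.trans ?_ (sum_norm_sq_mulVec U _)
  refine Finset.sum_congr rfl fun t _ => ?_
  simp only [applyLocal, Matrix.mulVec, dotProduct]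
  congr 2
  refine Finset.sum_congr rfl fun t' _ => ?_
  congr 2
  · refine congrArg (U.1 · t') (funext fun i => ?_)
    simp [i.2]
  · funext i
    by_cases h : owner i = p <;> simp [overwrite, h]

theorem Protocol.outputProb_nonneg {owner : Q → Player} {c : ℕ} (P : Protocol owner c)
    (ψ : State Q) (b : Bool) : 0 ≤ P.outputProb ψ b := by
  induction P generalizing ψ with
  | measure p U i => exact Finset.sum_nonneg fun s _ => by positivity
  | round p U i rest ih => exact ih _

theorem Protocol.outputProb_add {owner : Q → Player} {c : ℕ} (P : Protocol owner c)
    (ψ : State Q) : P.outputProb ψ true + P.outputProb ψ false = ∑ s, ‖ψ s‖ ^ 2 := by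
  induction P generalizing ψ with
  | measure p U i =>
    rw [← sum_norm_sq_applyLocal _ p U, Protocol.outputProb, Protocol.outputProb,
      ← Finset.sum_add_distrib]
    refine Finset.sum_congr rfl fun s _ => ?_
    cases s i.1 <;> simp
  | round p U i rest ih =>
    rw [Protocol.outputProb, Protocol.outputProb, ih, sum_norm_sq_applyLocal]

/-! ### Factorisation of the state between the players -/

theorem Player.other_ne (p : Player) : p.other ≠ p := by cases p <;> simp [Player.other]

theorem Player.ne_iff {p q : Player} : q ≠ p ↔ q = p.other := by
  cases p <;> cases q <;> simp [Player.other]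

/-- The part of a basis string that is held by `p`. -/
def part (owner : Q → Player) (p : Player) (s : Q → Bool) : Held owner p → Bool :=
  fun i => s i.1

/-- The family of states `ψ`, indexed by the inputs of the players, is a sum over `m : I` of
products of a vector of player `p` and a vector of the other player, where each depends only on
the input of the player concerned. -/
def Factors {X I : Type} [Fintype I] (owner : Q → Player) (p : Player)
    (A : I → X → (Held owner p → Bool) → ℂ) (B : I → X → (Held owner p.other → Bool) → ℂ)
    (ψ : (Player → X) → State Q) : Prop :=
  ∀ w s, ψ w s = ∑ m, A m (w p) (part owner p s) * B m (w p.other) (part owner p.other s)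

theorem Factors.applyLocal {X I : Type} [Fintype I] {owner : Q → Player} {p : Player}
    {A : I → X → (Held owner p → Bool) → ℂ} {B : I → X → (Held owner p.other → Bool) → ℂ}
    {ψ : (Player → X) → State Q} (h : Factors owner p A B ψ)
    (U : Matrix (Held owner p → Bool) (Held owner p → Bool) ℂ) :
    Factors owner p (fun m x => U.mulVec (A m x)) B
      (fun w => QuantumCommunication.applyLocal owner p U (ψ w)) := by
  intro w s
  have e1 : ∀ t, part owner p (overwrite owner p s t) = t := fun t => by
    funext i
    exact overwrite_held owner p s t i
  have e2 : ∀ t, part owner p.other (overwrite owner p s t) = part owner p.other s := fun t => by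
    funext i
    exact overwrite_not_held s t (by rw [i.2]; exact p.other_ne)
  simp only [QuantumCommunication.applyLocal, h w, e1, e2, Matrix.mulVec, dotProduct,
    Finset.mul_sum, Finset.sum_mul]
  rw [Finset.sum_comm]
  refine Finset.sum_congr rfl fun m _ => Finset.sum_congr rfl fun t _ => ?_
  rw [← mul_assoc]
  rfl

/-- The family of states `ψ` has a factorisation in which both families of vectors have total
squared norm at most `R`. -/
def FactorsLE {X : Type} (owner : Q → Player) (p : Player) (ψ : (Player → X) → State Q)
    (R : ℝ) : Prop :=
  ∃ (I : Type) (_ : Fintype I) (A : I → X → (Held owner p → Bool) → ℂ)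
    (B : I → X → (Held owner p.other → Bool) → ℂ), Factors owner p A B ψ ∧
    (∀ x, ∑ m, ∑ s, ‖A m x s‖ ^ 2 ≤ R) ∧ ∀ x, ∑ m, ∑ s, ‖B m x s‖ ^ 2 ≤ R

theorem FactorsLE.swap {X : Type} {owner : Q → Player} {p : Player}
    {ψ : (Player → X) → State Q} {R : ℝ} (h : FactorsLE owner p ψ R) :
    FactorsLE owner p.other ψ R := by
  obtain ⟨I, _, A, B, h1, h2, h3⟩ := h
  -- `p.other.other` reduces to `p` only for a concrete player.
  cases p
  all_goals
    refine ⟨I, inferInstance, B, A, fun w s => ?_, h3, h2⟩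
    rw [h1 w s]
    exact Finset.sum_congr rfl fun m _ => mul_comm _ _

theorem FactorsLE.switch {X : Type} {owner : Q → Player} {p : Player}
    {ψ : (Player → X) → State Q} {R : ℝ} (h : FactorsLE owner p ψ R) (q : Player) :
    FactorsLE owner q ψ R := by
  by_cases hq : q = p
  · rwa [hq]
  · rw [Player.ne_iff.1 hq]
    exact h.swap

theorem sum_comp_le_of_injective {S T : Type} [Fintype S] [Fintype T] {e : S → T}
    (he : Function.Injective e) {g : T → ℝ} (hg : ∀ t, 0 ≤ g t) : ∑ s, g (e s) ≤ ∑ t, g t := by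
  classical
  rw [← Finset.sum_image (f := g) (he.injOn)]
  exact Finset.sum_le_sum_of_subset_of_nonneg (Finset.subset_univ _) fun t _ _ => hg t

/-- Sending a qubit at most doubles the norms in a factorisation. -/
theorem FactorsLE.send {X : Type} {owner : Q → Player} {p : Player}
    {ψ : (Player → X) → State Q} {R : ℝ} (h : FactorsLE owner p ψ R) (i : Held owner p) :
    FactorsLE (Function.update owner i.1 p.other) p ψ (2 * R) := by
  obtain ⟨I, _, A, B, h1, h2, h3⟩ := h
  have own : ∀ j : Held owner p, j.1 ≠ i.1 → Function.update owner i.1 p.other j.1 = p := by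
    intro j hj
    rw [Function.update_of_ne hj, j.2]
  have own' : ∀ j : Held owner p.other, Function.update owner i.1 p.other j.1 = p.other := by
    intro j
    by_cases hj : j.1 = i.1
    · rw [hj, Function.update_self]
    · rw [Function.update_of_ne hj, j.2]
  let i' : Held (Function.update owner i.1 p.other) p.other := ⟨i.1, Function.update_self ..⟩
  let ext : (Held (Function.update owner i.1 p.other) p → Bool) × Bool → Held owner p → Bool :=
    fun t j => if hj : j.1 = i.1 then t.2 else t.1 ⟨j.1, own j hj⟩
  let res : (Held (Function.update owner i.1 p.other) p.other → Bool) →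
      (Held owner p.other → Bool) := fun t j => t ⟨j.1, own' j⟩
  have ext_inj : Function.Injective ext := by
    rintro ⟨t, b⟩ ⟨t', b'⟩ he
    refine Prod.ext (funext fun j => ?_) ?_
    · have hj : j.1 ≠ i.1 := fun hj => p.other_ne (by
        have := j.2
        rwa [hj, Function.update_self] at this)
      have hj' : owner j.1 = p := by
        have := j.2
        rwa [Function.update_of_ne hj] at this
      simpa [ext, hj] using congrFun he ⟨j.1, hj'⟩
    · simpa [ext] using congrFun he i
  have res_inj : Function.Injective fun t => (t i', res t) := by
    intro t t' he
    simp only [Prod.mk.injEq] at he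
    funext j
    by_cases hj : j.1 = i.1
    · have : j = i' := Subtype.ext hj
      rw [this, he.1]
    · have hj' : owner j.1 = p.other := by
        have := j.2
        rwa [Function.update_of_ne hj] at this
      exact congrFun he.2 ⟨j.1, hj'⟩
  -- The new index records the value of the sent qubit. The sender's vectors are cut into two
  -- slices, keeping their total norm; the receiver's vectors appear once for each value, which is
  -- the source of the factor 2.
  refine ⟨I × Bool, inferInstance, fun m x t => A m.1 x (ext (t, m.2)),
    fun m x t => if t i' = m.2 then B m.1 x (res t) else 0, fun w s => ?_, fun x => ?_,
    fun x => ?_⟩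
  · rw [h1 w s, Fintype.sum_prod_type]
    refine Finset.sum_congr rfl fun m _ => ?_
    rw [Finset.sum_eq_single (s i.1)]
    · have e1 : ext (part _ p s, s i.1) = part owner p s := by
        funext j
        by_cases hj : j.1 = i.1 <;> simp [ext, part, hj]
      have e2 : res (part _ p.other s) = part owner p.other s := rfl
      have e3 : part (Function.update owner i.1 p.other) p.other s i' = s i.1 := rfl
      simp only [e1, e2, e3, if_true]
    · intro b _ hb
      have e3 : part (Function.update owner i.1 p.other) p.other s i' = s i.1 := rfl
      simp only [e3, if_neg hb.symm, mul_zero]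
    · simp
  · have hR : 0 ≤ R := le_trans (by positivity) (h2 x)
    refine le_trans ?_ (show R ≤ 2 * R by linarith)
    refine le_trans ?_ (h2 x)
    rw [Fintype.sum_prod_type]
    refine Finset.sum_le_sum fun m _ => ?_
    rw [Finset.sum_comm, ← Fintype.sum_prod_type' (f := fun t b => ‖A m x (ext (t, b))‖ ^ 2)]
    exact sum_comp_le_of_injective ext_inj (g := fun t => ‖A m x t‖ ^ 2) fun t => by positivity
  · refine le_trans ?_ (mul_le_mul_of_nonneg_left (h3 x) zero_le_two)
    rw [Fintype.sum_prod_type, Finset.mul_sum]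
    refine Finset.sum_le_sum fun m _ => ?_
    have e : ∀ t : Held (Function.update owner i.1 p.other) p.other → Bool,
        ∑ b, ‖if t i' = b then B m x (res t) else 0‖ ^ 2 = ‖B m x (res t)‖ ^ 2 := by
      intro t
      rw [Finset.sum_eq_single (t i') (fun b _ hb => by simp [if_neg hb.symm]) (by simp), if_pos rfl]
    refine Finset.sum_comm.trans_le ((Finset.sum_congr rfl fun t _ => e t).trans_le ?_)
    have := sum_comp_le_of_injective res_inj (g := fun t => ‖B m x t.2‖ ^ 2) fun t => by positivity
    rw [Fintype.sum_prod_type] at this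
    simpa using this

theorem FactorsLE.applyLocal {X : Type} {owner : Q → Player} {p : Player}
    {ψ : (Player → X) → State Q} {R : ℝ} (h : FactorsLE owner p ψ R)
    (U : Matrix.unitaryGroup (Held owner p → Bool) ℂ) :
    FactorsLE owner p (fun w => QuantumCommunication.applyLocal owner p U.1 (ψ w)) R := by
  obtain ⟨I, _, A, B, h1, h2, h3⟩ := h
  refine ⟨I, inferInstance, _, B, h1.applyLocal U.1, fun x => ?_, h3⟩
  simpa only [sum_norm_sq_mulVec] using h2 x

/-- Splitting a basis string into the parts held by the two players. -/
theorem sum_parts (owner : Q → Player) (p : Player) {α : Type} [AddCommMonoid α]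
    (g : (Held owner p → Bool) → (Held owner p.other → Bool) → α) :
    ∑ s, g (part owner p s) (part owner p.other s) = ∑ t, ∑ r, g t r := by
  rw [← Fintype.sum_prod_type']
  refine Fintype.sum_bijective (fun s => (part owner p s, part owner p.other s)) ⟨?_, ?_⟩ _ _
    fun s => rfl
  · intro s s' h
    simp only [Prod.mk.injEq] at h
    funext i
    by_cases hi : owner i = p
    · exact congrFun h.1 ⟨i, hi⟩
    · exact congrFun h.2 ⟨i, Player.ne_iff.1 hi⟩
  · rintro ⟨t, r⟩
    refine ⟨fun i => if h : owner i = p then t ⟨i, h⟩ else r ⟨i, Player.ne_iff.1 h⟩, ?_⟩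
    refine Prod.ext (funext fun i => ?_) (funext fun i => ?_)
    · simp [part, i.2]
    · simp [part, i.2, p.other_ne]

/-! ### Measurement and the matrix of output probabilities -/

/-- The output probability of a measurement in terms of a factorisation of the state. -/
theorem Factors.measure_eq {X I : Type} [Fintype I] {owner : Q → Player} {p : Player}
    {A : I → X → (Held owner p → Bool) → ℂ} {B : I → X → (Held owner p.other → Bool) → ℂ}
    {ψ : (Player → X) → State Q} (h : Factors owner p A B ψ) (i : Held owner p) (b : Bool)
    (w : Player → X) :
    ((∑ s : Q → Bool, if s i.1 = b then ‖ψ w s‖ ^ 2 else 0 : ℝ) : ℂ) =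
      ∑ k : I × I, (∑ t, if t i = b then A k.1 (w p) t * star (A k.2 (w p) t) else 0) *
        ∑ r, B k.1 (w p.other) r * star (B k.2 (w p.other) r) := by
  -- Squaring gives a sum over pairs from `I × I`. The event concerns only `t`, so each term splits
  -- into two Gram entries.
  let g : (Held owner p → Bool) → (Held owner p.other → Bool) → ℂ := fun t r =>
    ∑ k : I × I, (if t i = b then A k.1 (w p) t * star (A k.2 (w p) t) else 0) *
      (B k.1 (w p.other) r * star (B k.2 (w p.other) r))
  have e : ∀ s : Q → Bool, ((if s i.1 = b then ‖ψ w s‖ ^ 2 else 0 : ℝ) : ℂ) =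
      g (part owner p s) (part owner p.other s) := by
    intro s
    simp only [g]
    have : part owner p s i = s i.1 := rfl
    simp only [this]
    split_ifs
    · rw [ofReal_norm_sq, h w s, star_sum, Finset.sum_mul_sum, Fintype.sum_prod_type]
      refine Finset.sum_congr rfl fun m _ => Finset.sum_congr rfl fun m' _ => ?_
      rw [star_mul']
      ring
    · simp
  rw [Complex.ofReal_sum, Finset.sum_congr rfl fun s _ => e s]
  refine (sum_parts owner p g).trans ?_
  simp only [g, Finset.sum_mul_sum]
  rw [Finset.sum_comm (s := (Finset.univ : Finset (I × I)))]
  exact Finset.sum_congr rfl fun t _ => Finset.sum_comm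

theorem norm_sq_sum_mul_star_le {T : Type} [Fintype T] (u v : T → ℂ) :
    ‖∑ t, u t * star (v t)‖ ^ 2 ≤ (∑ t, ‖u t‖ ^ 2) * ∑ t, ‖v t‖ ^ 2 := by
  refine le_trans (pow_le_pow_left₀ (norm_nonneg _) (norm_sum_le _ _) 2) ?_
  simpa only [norm_mul, norm_star] using
    Finset.sum_mul_sq_le_sq_mul_sq Finset.univ (fun t => ‖u t‖) fun t => ‖v t‖

/-- Cauchy–Schwarz for each entry; the resulting bound is a product in the two indices and sums to a
square. -/
theorem sum_gram_le {I T : Type} [Fintype I] [Fintype T] {A : I → T → ℂ} {R : ℝ}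
    (hA : ∑ m, ∑ t, ‖A m t‖ ^ 2 ≤ R) (P : T → Prop) [DecidablePred P] :
    ∑ k : I × I, ‖∑ t, if P t then A k.1 t * star (A k.2 t) else 0‖ ^ 2 ≤ R ^ 2 := by
  have h : ∀ k : I × I, ‖∑ t, if P t then A k.1 t * star (A k.2 t) else 0‖ ^ 2
      ≤ (∑ t, ‖A k.1 t‖ ^ 2) * ∑ t, ‖A k.2 t‖ ^ 2 := by
    intro k
    have e : ∀ t, (if P t then A k.1 t * star (A k.2 t) else 0)
        = (if P t then A k.1 t else 0) * star (A k.2 t) := fun t => by split_ifs <;> simp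
    simp only [e]
    refine (norm_sq_sum_mul_star_le _ _).trans ?_
    gcongr
    split_ifs <;> simp
  refine (Finset.sum_le_sum fun k _ => h k).trans ?_
  rw [Fintype.sum_prod_type]
  dsimp only
  rw [← Finset.sum_mul_sum, ← sq]
  exact pow_le_pow_left₀ (by positivity) hA 2

theorem FactorsLE.measure {X : Type} {owner : Q → Player} {p : Player}
    {ψ : (Player → X) → State Q} {R : ℝ} (h : FactorsLE owner p ψ R) (i : Held owner p)
    (b : Bool) : ∃ (K : Type) (_ : Fintype K) (u v : K → X → ℂ),
      (∀ w, ((∑ s : Q → Bool, if s i.1 = b then ‖ψ w s‖ ^ 2 else 0 : ℝ) : ℂ)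
        = ∑ k, u k (w p) * v k (w p.other)) ∧
      (∀ x, ∑ k, ‖u k x‖ ^ 2 ≤ R ^ 2) ∧ ∀ x, ∑ k, ‖v k x‖ ^ 2 ≤ R ^ 2 := by
  obtain ⟨I, _, A, B, h1, h2, h3⟩ := h
  refine ⟨I × I, inferInstance,
    fun k x => ∑ t, if t i = b then A k.1 x t * star (A k.2 x t) else 0,
    fun k x => ∑ r, B k.1 x r * star (B k.2 x r), h1.measure_eq i b,
    fun x => sum_gram_le (h2 x) fun t => t i = b, fun x => ?_⟩
  simpa only [if_true] using sum_gram_le (h3 x) fun _ => True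

/-- The matrix of output probabilities of a protocol with `c` qubits of communication. -/
theorem FactorsLE.outputProb {X : Type} {owner : Q → Player} {c : ℕ} (P : Protocol owner c)
    {ψ : (Player → X) → State Q} {R : ℝ} (h : FactorsLE owner .alice ψ R) (b : Bool) :
    GammaTwoLE (fun x y => ((P.outputProb (ψ fun q => if q = .alice then x else y) b : ℝ) : ℂ))
      ((2 ^ c * R) ^ 2) := by
  induction P generalizing ψ R with
  | measure p U i =>
    obtain ⟨K, _, u, v, h1, h2, h3⟩ := ((h.switch p).applyLocal U).measure i b
    rw [pow_zero, one_mul]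
    cases p
    · exact ⟨K, inferInstance, u, v, fun x y => h1 _, h2, h3⟩
    · exact ⟨K, inferInstance, v, u, fun x y => (h1 _).trans
        (Finset.sum_congr rfl fun k _ => mul_comm _ _), h3, h2⟩
  | @round owner c p U i rest ih =>
    have := ih ((((h.switch p).applyLocal U).send i).switch .alice)
    rwa [← mul_assoc, ← pow_succ] at this

end

/-! ### Protocols on inputs -/

/-- The initial state factors. -/
theorem initialState_factors {n a b : ℕ} :
    Factors (X := Str n) (I := Unit) (initialOwner n a b) .alice
      (fun _ x => Pi.single (part _ _ (initialString x x)) 1)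
      (fun _ y => Pi.single (part _ _ (initialString y y)) 1)
      (fun w => initialState (w .alice) (w .bob)) := by
  intro w s
  -- A player's part of the initial string involves only that player's input, so the other argument
  -- of `initialString` is a dummy.
  have e : s = initialString (w .alice) (w .bob) ↔
      part (initialOwner n a b) .alice s
        = part (initialOwner n a b) .alice (initialString (w .alice) (w .alice)) ∧
      part (initialOwner n a b) .bob s
        = part (initialOwner n a b) .bob (initialString (w .bob) (w .bob)) := by
    constructor
    · rintro rfl
      constructor <;> funext i <;> obtain ⟨(i | i) | (i | i), hi⟩ := i <;>
        first | rfl | cases hi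
    · rintro ⟨h1, h2⟩
      funext i
      rcases i with i | i
      · exact (congrFun h1 ⟨.inl i, rfl⟩).trans rfl
      · exact (congrFun h2 ⟨.inr i, rfl⟩).trans rfl
  simp only [initialState, Finset.univ_unique, Finset.sum_singleton]
  rw [Pi.single_apply, Pi.single_apply, Pi.single_apply, if_congr e rfl rfl, ite_and, ite_mul,
    one_mul, zero_mul]
  rfl

theorem sum_norm_sq_single {T : Type} [Fintype T] [DecidableEq T] (t : T) :
    ∑ s, ‖(Pi.single t (1 : ℂ) : T → ℂ) s‖ ^ 2 = 1 := by
  rw [Finset.sum_eq_single t] <;> simp +contextual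

theorem initialState_factorsLE {n a b : ℕ} :
    FactorsLE (initialOwner n a b) .alice
      (fun w : Player → Str n => initialState (w .alice) (w .bob)) 1 :=
  ⟨Unit, inferInstance, _, _, initialState_factors,
    fun x => by simp only [sum_norm_sq_single]; simp,
    fun x => by simp only [sum_norm_sq_single]; simp⟩

theorem Protocol.gammaTwoLE {n a b c : ℕ} (P : Protocol (initialOwner n a b) c) :
    GammaTwoLE (fun x y => ((P.outputProb (initialState x y) true : ℝ) : ℂ)) (4 ^ c) := by
  have := initialState_factorsLE.outputProb P true
  rw [mul_one, ← pow_mul, mul_comm, pow_mul] at this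
  norm_num at this
  exact this

/-- Without communication the output distribution depends on the input of one player only. -/
theorem Protocol.outputProb_zero {n a b : ℕ} (P : Protocol (initialOwner n a b) 0) (o : Bool) :
    (∀ x y y', P.outputProb (initialState x y) o = P.outputProb (initialState x y') o) ∨
    (∀ x x' y, P.outputProb (initialState x y) o = P.outputProb (initialState x' y) o) := by
  cases P with
  | measure p U i =>
    -- The player who does not measure contributes the squared norm of a basis vector, which is 1
    -- for every input.
    have key : ∀ {T : Type} [Fintype T] [DecidableEq T] (t : T),
        ∑ r, (Pi.single t (1 : ℂ) : T → ℂ) r * star ((Pi.single t (1 : ℂ) : T → ℂ) r) = 1 := by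
      intro T _ _ t
      simp only [← ofReal_norm_sq, ← Complex.ofReal_sum, sum_norm_sq_single, Complex.ofReal_one]
    cases p with
    | alice =>
      left
      intro x y y'
      have := fun y => (initialState_factors.applyLocal U.1).measure_eq i o
        (fun q => if q = .alice then x else y)
      simp only [key] at this
      exact Complex.ofReal_injective ((this y).trans (this y').symm)
    | bob =>
      right
      intro x x' y
      have sw : Factors (X := Str n) (I := Unit) (initialOwner n a b) .bob
          (fun _ y => Pi.single (part _ _ (initialString y y)) 1)
          (fun _ x => Pi.single (part _ _ (initialString x x)) 1)
          (fun w => initialState (w .alice) (w .bob)) := fun w s =>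
        (initialState_factors w s).trans (Finset.sum_congr rfl fun _ _ => mul_comm _ _)
      have := fun x => (sw.applyLocal U.1).measure_eq i o
        (fun q => if q = .alice then x else y)
      simp only [key] at this
      exact Complex.ofReal_injective ((this x).trans (this x').symm)

end QuantumCommunication
namespace QuantumCommunication

/-! ### Lower bounds on the communication -/

/-- Existence of some protocol is essential: `sInf ∅ = 0` in `ℕ`. -/
theorem BQC_spec {n : ℕ} (f : Str n → Str n → Bool) :
    ∃ (a b : ℕ) (P : Protocol (initialOwner n a b) (BQC f)), P.Computes (1 / 3) f := by
  obtain ⟨c, hc⟩ := exists_protocol (ε := 1 / 3) (by norm_num) f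
  exact Nat.sInf_mem (s := {c : ℕ | ∃ (a b : ℕ) (P : Protocol (initialOwner n a b) c),
    P.Computes (1 / 3) f}) ⟨c, hc⟩

theorem outputProb_initialState_add {n a b c : ℕ} (P : Protocol (initialOwner n a b) c)
    (x y : Str n) :
    P.outputProb (initialState x y) true + P.outputProb (initialState x y) false = 1 := by
  rw [P.outputProb_add, initialState, sum_norm_sq_single]

theorem abs_le_one_of_range {n : ℕ} {f : Str n → Str n → Bool} {F : Str n → Str n → ℝ}
    (hF : F = zeroOne f ∨ F = plusMinusOne f) (x y : Str n) : ‖(F x y : ℂ)‖ ≤ 1 := by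
  rcases hF with rfl | rfl <;> cases h : f x y <;> simp [zeroOne, plusMinusOne, h]

theorem κ₁_le_sqrt {n : ℕ} {f : Str n → Str n → Bool} {F : Str n → Str n → ℝ}
    {E : Finset (Str n × Str n)} (hF : F = zeroOne f ∨ F = plusMinusOne f)
    (hE : (E : Set (Str n × Str n)) ⊆ diagonalIndices n) : κ₁ F E ≤ √(κ₀ E : ℝ) := by
  rw [κ₁_eq hE]
  simpa using sum_norm_diagCoeff_le hE zero_le_one (abs_le_one_of_range hF)

/-- Split `F = M + (F - M)`: the `γ₂` bound serves `M`, Bessel serves the error. -/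
theorem κ₁_le_of_gammaTwoLE {n : ℕ} {F : Str n → Str n → ℝ}
    {E : Finset (Str n × Str n)} (hE : (E : Set (Str n × Str n)) ⊆ diagonalIndices n)
    {M : Str n → Str n → ℝ} {R ε : ℝ} (hM : GammaTwoLE (fun x y => (M x y : ℂ)) R)
    (hε : 0 ≤ ε) (h : ∀ x y, |F x y - M x y| ≤ ε) : κ₁ F E ≤ R + ε * √(κ₀ E : ℝ) := by
  have e : (fun x y => (F x y : ℂ))
      = fun x y => (M x y : ℂ) + ((F x y - M x y : ℝ) : ℂ) := by
    funext x y
    push_cast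
    ring
  rw [κ₁_eq hE, e]
  calc _ ≤ ∑ p ∈ E, (‖diagCoeff (fun x y => (M x y : ℂ)) p.1‖
          + ‖diagCoeff (fun x y => ((F x y - M x y : ℝ) : ℂ)) p.1‖) :=
        Finset.sum_le_sum fun p _ => by
          rw [diagCoeff_add (fun x y => (M x y : ℂ))]
          exact norm_add_le _ _
    _ ≤ _ := by
        rw [Finset.sum_add_distrib]
        refine add_le_add ((sum_diagonal_le hE (h := fun z =>
          ‖diagCoeff (fun x y => (M x y : ℂ)) z‖) fun z => norm_nonneg _).trans
          hM.sum_norm_diagCoeff_le) (sum_norm_diagCoeff_le hE hε fun x y => ?_)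
        rw [Complex.norm_real]
        exact h x y

/-- A function that can be computed without communication depends on one input only. -/
theorem κ₁_le_one_of_BQC_eq_zero {n : ℕ} {f : Str n → Str n → Bool} {F : Str n → Str n → ℝ}
    {E : Finset (Str n × Str n)} (hF : F = zeroOne f ∨ F = plusMinusOne f)
    (hE : (E : Set (Str n × Str n)) ⊆ diagonalIndices n) (h0 : BQC f = 0) : κ₁ F E ≤ 1 := by
  have spec := BQC_spec f
  rw [h0] at spec
  obtain ⟨a, b, P, hP⟩ := spec
  -- Two different answers cannot both have probability at least `2/3` under one distribution.
  have value : ∀ x y x' y', P.outputProb (initialState x y) true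
      = P.outputProb (initialState x' y') true → f x y = f x' y' := by
    intro x y x' y' h
    have e1 := hP x y
    have e2 := hP x' y'
    have s1 := outputProb_initialState_add P x y
    have s2 := outputProb_initialState_add P x' y'
    cases h1 : f x y <;> cases h2 : f x' y' <;> rw [h1] at e1 <;> rw [h2] at e2 <;>
      first | rfl | (exfalso; linarith)
  have range : ∀ x y x' y', f x y = f x' y' → F x y = F x' y' := by
    intro x y x' y' h
    rcases hF with rfl | rfl <;> simp only [zeroOne, plusMinusOne, h]
  have hM : GammaTwoLE (fun x y => (F x y : ℂ)) 1 := by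
    rcases P.outputProb_zero true with h | h
    · have : (fun x y => (F x y : ℂ)) = fun x _ => (F x fun _ => false : ℂ) := by
        funext x y
        rw [range _ _ _ _ (value _ _ _ _ (h x y fun _ => false))]
      rw [this]
      exact GammaTwoLE.of_left fun x => abs_le_one_of_range hF _ _
    · have : (fun x y => (F x y : ℂ)) = fun _ y => (F (fun _ => false) y : ℂ) := by
        funext x y
        rw [range _ _ _ _ (value _ _ _ _ (h x (fun _ => false) y))]
      rw [this]
      exact GammaTwoLE.of_right fun x => abs_le_one_of_range hF _ _
  simpa using κ₁_le_of_gammaTwoLE hE hM le_rfl (by simp)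

/-- The Fourier bound after amplification of the success probability. -/
theorem κ₁_le_of_BQC {n : ℕ} {f : Str n → Str n → Bool} {F : Str n → Str n → ℝ}
    {E : Finset (Str n × Str n)} (hF : F = zeroOne f ∨ F = plusMinusOne f)
    (hE : (E : Set (Str n × Str n)) ⊆ diagonalIndices n) (m : ℕ) :
    κ₁ F E ≤ (2 * (1 + 2 * 4 ^ BQC f) ^ (2 * m) + 1) + 2 * (8 / 9) ^ m * √(κ₀ E : ℝ) := by
  obtain ⟨a, b, P, hP⟩ := BQC_spec f
  set M : Str n → Str n → ℝ := fun x y => majorityPoly m (P.outputProb (initialState x y) true)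
    with hMdef
  have hM : GammaTwoLE (fun x y => (M x y : ℂ)) ((1 + 2 * 4 ^ BQC f) ^ (2 * m)) := by
    have := P.gammaTwoLE.majorityPoly (by positivity) m
    simpa [hMdef, majorityPoly] using this
  have err : ∀ x y, |zeroOne f x y - M x y| ≤ (8 / 9) ^ m := by
    intro x y
    have e := hP x y
    have s := outputProb_initialState_add P x y
    have p0 := P.outputProb_nonneg (initialState x y) true
    have p1 := P.outputProb_nonneg (initialState x y) false
    have m0 := majorityPoly_nonneg (m := m) p0 (by linarith)
    have m1 := majorityPoly_le_one (m := m) p0 (by linarith)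
    cases h : f x y <;> rw [h] at e
    · have := majorityPoly_le (m := m) p0 (by linarith)
      simpa [zeroOne, h, hMdef, abs_of_nonneg m0] using this
    · have := one_sub_majorityPoly_le (m := m)
        (t := P.outputProb (initialState x y) true) (by linarith) (by linarith)
      simpa [zeroOne, h, hMdef, abs_of_nonneg (sub_nonneg.2 m1)] using this
  rcases hF with rfl | rfl
  · refine (κ₁_le_of_gammaTwoLE hE hM (by positivity) err).trans ?_
    have h1 : (0 : ℝ) ≤ (1 + 2 * 4 ^ BQC f) ^ (2 * m) := by positivity
    have h2 : (0 : ℝ) ≤ (8 / 9) ^ m * √(κ₀ E : ℝ) := by positivity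
    linarith
  -- Passing to `2 M - 1` doubles the error; the resulting constants also cover the range `{0, 1}`.
  · have hM' : GammaTwoLE (fun x y => ((2 * M x y - 1 : ℝ) : ℂ))
        (2 * (1 + 2 * 4 ^ BQC f) ^ (2 * m) + 1) := by
      simpa [sub_eq_add_neg] using (hM.smul (a := 2) zero_le_two).add GammaTwoLE.one.neg
    refine κ₁_le_of_gammaTwoLE hE hM' (by positivity) fun x y => ?_
    have : plusMinusOne f x y - (2 * M x y - 1) = 2 * (zeroOne f x y - M x y) := by
      cases h : f x y <;> simp [plusMinusOne, zeroOne, h] <;> ring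
    rw [this, abs_mul, abs_two]
    exact mul_le_mul_of_nonneg_left (err x y) zero_le_two

/-- Amplification is tuned so that the error term is at most `κ₁ / 2`; the remaining term then
bounds `κ₁`. -/
theorem logb_κ₁_le {n : ℕ} {f : Str n → Str n → Bool} {F : Str n → Str n → ℝ}
    {E : Finset (Str n × Str n)} (hF : F = zeroOne f ∨ F = plusMinusOne f)
    (hE : (E : Set (Str n × Str n)) ⊆ diagonalIndices n) (hpos : 0 < κ₁ F E) :
    1 ≤ Real.logb 2 (√(κ₀ E : ℝ)) - Real.logb 2 (κ₁ F E) + 1 ∧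
    Real.logb 2 (κ₁ F E) ≤ 198 * (BQC f : ℝ) *
      (Real.logb 2 (√(κ₀ E : ℝ)) - Real.logb 2 (κ₁ F E) + 1) := by
  have hle := κ₁_le_sqrt hF hE
  have hs : 0 < √(κ₀ E : ℝ) := hpos.trans_le hle
  set K := κ₁ F E with hK
  set S := √(κ₀ E : ℝ)
  set D := Real.logb 2 S - Real.logb 2 K + 1 with hD
  have hD1 : 1 ≤ D := by
    have := Real.logb_le_logb_of_le one_lt_two hpos hle
    linarith
  refine ⟨hD1, ?_⟩
  -- The amplified bound involves `c + 1`, which is `O(c)` only for `c ≥ 1`.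
  rcases Nat.eq_zero_or_pos (BQC f) with h0 | hc
  · have h1 := κ₁_le_one_of_BQC_eq_zero hF hE h0
    rw [h0]
    simpa using Real.logb_nonpos one_lt_two hpos.le h1
  set c := BQC f
  set d := ⌈D⌉₊ + 1 with hd
  have hd1 : D + 1 ≤ d := by
    rw [hd]
    push_cast
    linarith [Nat.le_ceil D]
  have hd2 : (d : ℝ) ≤ 3 * D := by
    rw [hd]
    push_cast
    linarith [(Nat.ceil_lt_add_one (show 0 ≤ D by linarith)).le]
  -- The factor 6 is chosen because `(8/9) ^ 6 ≤ 1/2`.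
  have key := κ₁_le_of_BQC hF hE (6 * d)
  have small : 2 * (8 / 9 : ℝ) ^ (6 * d) * S ≤ K / 2 := by
    have h1 : (8 / 9 : ℝ) ^ (6 * d) ≤ (1 / 2) ^ d := by
      rw [pow_mul]
      exact pow_le_pow_left₀ (by norm_num) (by norm_num) d
    -- The logarithm of the left side is `D + 1`, hence the lower bound `hd1` on `d`.
    have h2 : 4 * (S / K) ≤ 2 ^ d := by
      rw [← Real.rpow_natCast, ← Real.logb_le_iff_le_rpow one_lt_two (by positivity),
        Real.logb_mul (by norm_num) (by positivity), Real.logb_div hs.ne' hpos.ne',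
        show (4 : ℝ) = 2 ^ (2 : ℝ) by norm_num, Real.logb_rpow (by norm_num) (by norm_num)]
      linarith
    have h3 : 4 * S ≤ 2 ^ d * K := by
      rwa [← mul_div_assoc, div_le_iff₀ hpos] at h2
    have h4 : (1 / 2 : ℝ) ^ d * (4 * S) ≤ K := by
      calc _ ≤ (1 / 2 : ℝ) ^ d * (2 ^ d * K) := by gcongr
        _ = K := by rw [← mul_assoc, ← mul_pow]; norm_num
    have h5 := mul_le_mul_of_nonneg_right h1 (show 0 ≤ 4 * S by positivity)
    linarith
  -- From `K / 2 ≤ 2 T + 1` with `T ≥ 1` follows `K ≤ 8 T`, whence the 3 in the exponent.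
  have big : K ≤ 2 ^ (4 * (6 * d) * (c + 1) + 3) := by
    have h1 : (1 + 2 * 4 ^ c : ℝ) ≤ 4 ^ (c + 1) := by
      have : (1 : ℝ) ≤ 4 ^ c := one_le_pow₀ (by norm_num)
      rw [pow_succ]
      linarith
    have h2 : (1 + 2 * 4 ^ c : ℝ) ^ (2 * (6 * d)) ≤ 2 ^ (4 * (6 * d) * (c + 1)) := by
      refine (pow_le_pow_left₀ (by positivity) h1 _).trans (le_of_eq ?_)
      rw [← pow_mul, show (4 : ℝ) = 2 ^ 2 by norm_num, ← pow_mul]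
      congr 1
      ring
    have h3 : (1 : ℝ) ≤ 2 ^ (4 * (6 * d) * (c + 1)) := one_le_pow₀ (by norm_num)
    rw [pow_add]
    linarith
  have lg : Real.logb 2 K ≤ ((4 * (6 * d) * (c + 1) + 3 : ℕ) : ℝ) := by
    rw [Real.logb_le_iff_le_rpow one_lt_two hpos, Real.rpow_natCast]
    exact big
  have hnat : 4 * (6 * d) * (c + 1) + 3 ≤ 51 * d * c := by
    have hdpos : 1 ≤ d := by omega
    nlinarith [Nat.mul_le_mul hdpos hc]
  calc Real.logb 2 K ≤ ((51 * d * c : ℕ) : ℝ) := lg.trans (Nat.cast_le.2 hnat)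
    _ = 51 * c * d := by push_cast; ring
    _ ≤ 51 * c * (3 * D) := by gcongr
    _ ≤ 198 * c * D := by
      have : 0 ≤ (c : ℝ) * D := by positivity
      linarith

end QuantumCommunication

/-! ### The two regimes of the lower bound -/

theorem theorem4p1 :
    (∀ a : ℝ, 0 < a → ∃ C : ℝ, 0 < C ∧
      ∀ (n : ℕ) (f : Str n → Str n → Bool) (F : Str n → Str n → ℝ)
        (E : Finset (Str n × Str n)),
        F = zeroOne f ∨ F = plusMinusOne f →
        (E : Set (Str n × Str n)) ⊆ diagonalIndices n →
        0 < κ₁ F E →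
        a * √(κ₀ E : ℝ) ≤ κ₁ F E →
        C * Real.logb 2 (κ₁ F E) ≤ (BQC f : ℝ)) ∧
    (∀ b : ℝ, 0 < b → ∃ C : ℝ, 0 < C ∧
      ∀ (n : ℕ) (f : Str n → Str n → Bool) (F : Str n → Str n → ℝ)
        (E : Finset (Str n × Str n)),
        F = zeroOne f ∨ F = plusMinusOne f →
        (E : Set (Str n × Str n)) ⊆ diagonalIndices n →
        0 < κ₁ F E →
        κ₁ F E ≤ b * √(κ₀ E : ℝ) →
        C * (Real.logb 2 (κ₁ F E) /
            (Real.logb 2 (√(κ₀ E : ℝ)) - Real.logb 2 (κ₁ F E) + 1)) ≤ (BQC f : ℝ)) := by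
  constructor
  · intro a ha
    have hA : 0 < 1 + |Real.logb 2 a| := by positivity
    -- Here `D ≤ 1 - log a`; the absolute value keeps the constant positive for every `a`.
    refine ⟨1 / (198 * (1 + |Real.logb 2 a|)), by positivity, fun n f F E hF hE hpos hle => ?_⟩
    obtain ⟨h1, h2⟩ := logb_κ₁_le hF hE hpos
    have hs : 0 < √(κ₀ E : ℝ) := hpos.trans_le (κ₁_le_sqrt hF hE)
    have h3 := Real.logb_le_logb_of_le one_lt_two (mul_pos ha hs) hle
    rw [Real.logb_mul ha.ne' hs.ne'] at h3
    have h4 : Real.logb 2 (√(κ₀ E : ℝ)) - Real.logb 2 (κ₁ F E) + 1 ≤ 1 + |Real.logb 2 a| := by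
      linarith [neg_le_abs (Real.logb 2 a)]
    rw [div_mul_eq_mul_div, one_mul, div_le_iff₀ (by positivity)]
    calc _ ≤ _ := h2
      _ ≤ 198 * (BQC f : ℝ) * (1 + |Real.logb 2 a|) := by gcongr
      _ = _ := by ring
  · intro b _
    refine ⟨1 / 198, by norm_num, fun n f F E hF hE hpos _ => ?_⟩
    obtain ⟨h1, h2⟩ := logb_κ₁_le hF hE hpos
    -- The denominator is at least 1 because `κ₁ ≤ √κ₀`.
    rw [← mul_div_assoc, div_le_iff₀ (by linarith)]
    linarith
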